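/- **Setting.** Let $N\ge 1$ and let $P(0),P(1),\dots$ be i.i.d. random $N\times N$ matrices which almost surely are symmetric and stochastic with $P_{ii}(t)>0$ for all $i$. Let $\bar P=\mathbb E[P(t)]$ and $\bar{\bar P}=\mathbb E[P(t)^2]$, and assume that the directed graph on $\{1,\dots,N\}$ with an edge from $i$ to $j$ whenever $\bar P_{ij}>0$ has a globally reachable node (a node that can be reached from every node). Let $n(0),n(1),\dots$ be random vectors in $\mathbb R^N$ such that the process $(n(t))_{t\ge0}$ is independent of the process $(P(t))_{t\ge0}$ and the scalar variables $n_i(t)$ have zero mean, variance $\sigma^2<\infty$, and are pairwise uncorrelated over all distinct index pairs $(t,i)$. For an arbitrary fixed $x(0)\in\mathbb R^N$ let $$x(t+1)=P(t)x(t)+n(t),\qquad t\ge 0,$$ and define the noise index $$J_{\mathrm{noise}}=\frac1N\lim_{t\to\infty}\mathbb E\left[\left\|x(t)-\tfrac1N\mathbf 1\mathbf 1^{T}x(t)\right\|^2\right].$$ **Theorem 2 (Upper and lower bounds).** For a symmetric matrix $A$ write $\lambda_1(A)\ge\lambda_2(A)\ge\dots\ge\lambda_N(A)$ for its eigenvalues,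 with multiplicity. Then all the expectations above are finite, the limit exists, $\lambda_i(\bar P)^2<1$ and $\lambda_i(\bar{\bar P})<1$ for $2\le i\le N$, and $$\frac{\sigma^2}{N}\sum_{i=2}^N\frac{1}{1-\lambda_i(\bar P)^2}\;\le\; J_{\mathrm{noise}}\;\le\;\frac{\sigma^2}{N}\sum_{i=2}^N\frac{1}{1-\lambda_i(\bar{\bar P})}.$$ -/

import Mathlib

open MeasureTheory ProbabilityTheory Filter Topology

namespace NoisyConsensus

/-- Matrices carry the product (equivalently, Borel) σ-algebra of their entries. -/
instance instMeasurableSpaceMatrix {N : ℕ} : MeasurableSpace (Matrix (Fin N) (Fin N) ℝ) :=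
  inferInstanceAs (MeasurableSpace (Fin N → Fin N → ℝ))

/-- The entrywise expectation of a random matrix. -/
noncomputable def expMatrix {Ω : Type*} [MeasurableSpace Ω] (μ : Measure Ω) {N : ℕ}
    (A : Ω → Matrix (Fin N) (Fin N) ℝ) : Matrix (Fin N) (Fin N) ℝ :=
  Matrix.of fun i j => ∫ ω, A ω i j ∂μ

/-- In the directed graph with an edge from `i` to `j` exactly when `0 < A i j`, some node can be
reached from every node. -/
def HasGloballyReachableNode {N : ℕ} (A : Matrix (Fin N) (Fin N) ℝ) : Prop :=
  ∃ v, ∀ u, Relation.ReflTransGen (fun i j => 0 < A i j) u v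

/-- The trajectory of the noisy consensus dynamics `x (t + 1) = P t * x t + n t`, `x 0 = x₀`. -/
noncomputable def state {Ω : Type*} {N : ℕ} (P : ℕ → Ω → Matrix (Fin N) (Fin N) ℝ)
    (n : ℕ → Ω → EuclideanSpace ℝ (Fin N)) (x₀ : EuclideanSpace ℝ (Fin N)) :
    ℕ → Ω → EuclideanSpace ℝ (Fin N)
  | 0, _ => x₀
  | t + 1, ω => WithLp.toLp 2 ((P t ω).mulVec (state P n x₀ t ω).ofLp) + n t ω

/-- The deviation `x - N⁻¹ 𝟙 𝟙ᵀ x` of a vector from its average. -/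
noncomputable def deviation {N : ℕ} (x : EuclideanSpace ℝ (Fin N)) : EuclideanSpace ℝ (Fin N) :=
  x - WithLp.toLp 2 (((N : ℝ)⁻¹ • Matrix.vecMulVec (1 : Fin N → ℝ) 1).mulVec x.ofLp)

/-- The `i`-th eigenvalue, `1 ≤ i ≤ N`, of a symmetric matrix, in decreasing order and with
multiplicity: `eig hA 1 ≥ eig hA 2 ≥ … ≥ eig hA N` (and `0` for other `i`). -/
noncomputable def eig {N : ℕ} {A : Matrix (Fin N) (Fin N) ℝ} (hA : A.IsHermitian) (i : ℕ) : ℝ :=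
  if h : 1 ≤ i ∧ i ≤ N then hA.eigenvalues₀ ⟨i - 1, by rw [Fintype.card_fin]; omega⟩ else 0

end NoisyConsensus

/-!
Write `Φ s k = P (s + k - 1) ⋯ P s`. The state at time `t` is
`Φ 0 t x₀ + ∑ s < t, Φ (s + 1) (t - 1 - s) n s`, and since the `Φ`s are doubly
stochastic, its deviation from the average is obtained by subtracting the averaging matrix from each of them. The noise is orthogonal and independent of the `Φ`s, so the
mean squared deviation is a contribution of `x₀`, which tends to `0`, plus `σ ^ 2 * ∑ k < t, a k`
with `a k = 𝔼[‖Φ 0 k‖²] - 1` in the Frobenius norm (`integral_norm_deviation_sq`; `a` is called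
`disagreement`). Hence `N * J = σ ^ 2 * ∑' k, a k`, and both bounds are compared with this series
term by term, as geometric series in the eigenvalues.

* Lower bound (`le_disagreement`): by Jensen, `𝔼[‖Φ 0 k‖²] ≥ ‖𝔼[Φ 0 k]‖² = tr (𝔼[P] ^ (2 * k))`.
* Upper bound (`disagreement_le`): with `L X = 𝔼[P X P]` and `A = L 1 = 𝔼[P ^ 2]`, the claim is
  `tr (L^k 1) ≤ tr (A ^ k)`. It follows by induction from
  `tr (A ^ a * L^(j+1) 1) = tr (A ^ a * L^j A) ≤ tr (A ^ (a + 1) * L^j 1)`. In the eigenbasis of `A`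
  the last step compares sums with nonnegative weights `w i l = tr (uᵢ uᵢᵀ * L^j (uₗ uₗᵀ))`, which
  are symmetric because `L` is self-adjoint; it is then the rearrangement inequality
  (`vec_pow_dotProduct_mulVec_vec_le`). The map `L` is encoded as the matrix `𝔼[P ⊗ P]` acting on
  vectorized matrices, whose powers are the matrices `𝔼[Φ ⊗ Φ]` by independence.

The eigenvalue bounds come from connectivity: `𝔼[P ^ 2]` is positive semidefinite and stochastic,
and because the diagonals are positive its graph contains that of `𝔼[P]`, so its Dirichlet form
vanishes only on constant vectors. The estimate `(uᵀ 𝔼[P] u)² ≤ ‖u‖² * uᵀ 𝔼[P ^ 2] u` carries this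
over to `𝔼[P]`, including the bound away from `-1`.
-/

namespace NoisyConsensus

open Matrix
open scoped Kronecker

/-! ### Spectra of symmetric matrices -/

lemma pow_eq_sum_smul_vecMulVec {m : Type*} [Fintype m] [DecidableEq m] {A : Matrix m m ℝ}
    (hA : A.IsHermitian) (k : ℕ) :
    A ^ k = ∑ i, hA.eigenvalues i ^ k •
      vecMulVec (hA.eigenvectorBasis i).ofLp (hA.eigenvectorBasis i).ofLp := by
  have h : A ^ k = Unitary.conjStarAlgAut ℝ _ hA.eigenvectorUnitary
      (diagonal (fun i => hA.eigenvalues i ^ k)) := by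
    conv_lhs => rw [hA.spectral_theorem]
    rw [← map_pow, diagonal_pow]
    rfl
  rw [h]
  ext i j
  simp [Unitary.conjStarAlgAut_apply, Matrix.mul_apply, Matrix.sum_apply, vecMulVec_apply,
    diagonal_apply]
  refine Finset.sum_congr rfl fun x _ => by ring

lemma eigenvectorBasis_dotProduct_self {m : Type*} [Fintype m] [DecidableEq m] {A : Matrix m m ℝ}
    (hA : A.IsHermitian) (i : m) :
    (hA.eigenvectorBasis i).ofLp ⬝ᵥ (hA.eigenvectorBasis i).ofLp = 1 := by
  have h := hA.eigenvectorBasis.orthonormal.1 i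
  have h2 : inner ℝ (hA.eigenvectorBasis i) (hA.eigenvectorBasis i) = (1 : ℝ) := by
    rw [real_inner_self_eq_norm_sq, h]; norm_num
  rwa [EuclideanSpace.inner_eq_star_dotProduct, star_trivial] at h2

lemma eigenvectorBasis_dotProduct_of_ne {m : Type*} [Fintype m] [DecidableEq m]
    {A : Matrix m m ℝ} (hA : A.IsHermitian) {i j : m} (hij : i ≠ j) :
    (hA.eigenvectorBasis i).ofLp ⬝ᵥ (hA.eigenvectorBasis j).ofLp = 0 := by
  have h2 := hA.eigenvectorBasis.orthonormal.2 hij.symm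
  simpa [EuclideanSpace.inner_eq_star_dotProduct] using h2

lemma eigenvectorBasis_dotProduct_mulVec {m : Type*} [Fintype m] [DecidableEq m]
    {A : Matrix m m ℝ} (hA : A.IsHermitian) (i : m) :
    (hA.eigenvectorBasis i).ofLp ⬝ᵥ A *ᵥ (hA.eigenvectorBasis i).ofLp = hA.eigenvalues i := by
  rw [hA.mulVec_eigenvectorBasis, dotProduct_smul, eigenvectorBasis_dotProduct_self, smul_eq_mul,
    mul_one]

lemma trace_pow_eq_sum_eigenvalues {m : Type*} [Fintype m] [DecidableEq m] {A : Matrix m m ℝ}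
    (hA : A.IsHermitian) (k : ℕ) : (A ^ k).trace = ∑ i, hA.eigenvalues i ^ k := by
  rw [pow_eq_sum_smul_vecMulVec hA, trace_sum]
  simp [trace_smul, trace_vecMulVec, eigenvectorBasis_dotProduct_self]

lemma sum_eigenvalues_eq_sum_eig {N : ℕ} {A : Matrix (Fin N) (Fin N) ℝ} (hA : A.IsHermitian)
    (f : ℝ → ℝ) : ∑ i, f (hA.eigenvalues i) = ∑ i ∈ Finset.Icc 1 N, f (eig hA i) := by
  have h1 : ∑ i, f (hA.eigenvalues i) = ∑ i, f (hA.eigenvalues₀ i) :=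
    Equiv.sum_comp (Fintype.equivOfCardEq (Fintype.card_fin _)).symm
      (fun i => f (hA.eigenvalues₀ i))
  have h2 : ∑ i, f (hA.eigenvalues₀ i) =
      ∑ i ∈ Finset.range (Fintype.card (Fin N)), f (eig hA (i + 1)) := by
    rw [← Fin.sum_univ_eq_sum_range (fun i => f (eig hA (i + 1)))]
    refine Finset.sum_congr rfl fun i _ => ?_
    have hi : 1 ≤ (i : ℕ) + 1 ∧ (i : ℕ) + 1 ≤ N := by
      have := i.2; simp only [Fintype.card_fin] at this; omega
    rw [eig, dif_pos hi]
    rfl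
  rw [h1, h2, Fintype.card_fin, Finset.range_eq_Ico,
    Finset.sum_Ico_add' (fun i => f (eig hA i)) 0 N 1]
  rfl

/-- `eig` lists the family `eigenvalues`, up to a bijection of the indices. -/
lemma exists_eigenvalues_eq_eig {N : ℕ} {A : Matrix (Fin N) (Fin N) ℝ} (hA : A.IsHermitian) :
    ∃ e : Fin N ≃ Fin N, ∀ i : Fin N, hA.eigenvalues (e i) = eig hA (i + 1) := by
  refine ⟨(finCongr (Fintype.card_fin N)).symm.trans
    (Fintype.equivOfCardEq (Fintype.card_fin _)), fun i => ?_⟩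
  have hi : 1 ≤ (i : ℕ) + 1 ∧ (i : ℕ) + 1 ≤ N := by omega
  rw [eig, dif_pos hi]
  simp only [Matrix.IsHermitian.eigenvalues, Equiv.trans_apply, Equiv.symm_apply_apply]
  rfl

lemma eig_le_eig {N : ℕ} {A : Matrix (Fin N) (Fin N) ℝ} (hA : A.IsHermitian) {i j : ℕ}
    (hi : 1 ≤ i) (hij : i ≤ j) (hj : j ≤ N) : eig hA j ≤ eig hA i := by
  rw [eig, eig, dif_pos ⟨hi.trans hij, hj⟩, dif_pos ⟨hi, hij.trans hj⟩]
  exact hA.eigenvalues₀_antitone (by simp only [Fin.mk_le_mk]; omega)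

/-- A symmetric matrix that fixes the constant vectors and is a strict contraction, as a quadratic
form, on all others has `1` as its simple top eigenvalue, and all other eigenvalues lie in
`(-1, 1)`. -/
lemma eig_of_quadratic_form {N : ℕ} (hN : 0 < N) {A : Matrix (Fin N) (Fin N) ℝ}
    (hA : A.IsHermitian) (hone : A *ᵥ 1 = 1)
    (hlt : ∀ u : Fin N → ℝ, (¬ ∃ c : ℝ, u = c • 1) → |u ⬝ᵥ A *ᵥ u| < u ⬝ᵥ u) :
    eig hA 1 = 1 ∧ ∀ i ∈ Finset.Icc 2 N, |eig hA i| < 1 := by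
  set b : Fin N → Fin N → ℝ := fun i => (hA.eigenvectorBasis i).ofLp with hb
  have hself : ∀ i, b i ⬝ᵥ b i = 1 := eigenvectorBasis_dotProduct_self hA
  have hne : ∀ i j, i ≠ j → b i ⬝ᵥ b j = 0 := fun i j => eigenvectorBasis_dotProduct_of_ne hA
  have hev : ∀ i, b i ⬝ᵥ A *ᵥ b i = hA.eigenvalues i := eigenvectorBasis_dotProduct_mulVec hA
  have hnc : ∀ i, (¬ ∃ c : ℝ, b i = c • 1) → |hA.eigenvalues i| < 1 := fun i h => by
    rw [← hev, ← hself i]; exact hlt _ h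
  have hc : ∀ i, (∃ c : ℝ, b i = c • 1) → hA.eigenvalues i = 1 := by
    rintro i ⟨c, h⟩
    rw [← hev, ← hself i, h, mulVec_smul, hone]
  have huniq : ∀ i j, (∃ c : ℝ, b i = c • 1) → (∃ c : ℝ, b j = c • 1) → i = j := by
    rintro i j ⟨c, h⟩ ⟨d, h'⟩
    by_contra hij
    have h1 := hne i j hij
    have h2 := hself i
    have h3 := hself j
    rw [h, h'] at h1
    rw [h] at h2
    rw [h'] at h3
    simp only [smul_dotProduct, dotProduct_smul, smul_eq_mul] at h1 h2 h3
    have : (c * (c * ((1 : Fin N → ℝ) ⬝ᵥ 1))) * (d * (d * ((1 : Fin N → ℝ) ⬝ᵥ 1))) = 0 := by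
      linear_combination (c * d * ((1 : Fin N → ℝ) ⬝ᵥ 1)) * h1
    rw [h2, h3] at this
    norm_num at this
  -- if no eigenvector were constant, `1` would be orthogonal to the whole eigenbasis
  have hex : ∃ i, ∃ c : ℝ, b i = c • 1 := by
    by_contra hcon
    push Not at hcon
    have horth : ∀ i, b i ⬝ᵥ 1 = 0 := by
      intro i
      have h1 : |hA.eigenvalues i| < 1 := hnc i (by push Not; exact hcon i)
      have h2 : b i ⬝ᵥ 1 = hA.eigenvalues i * (b i ⬝ᵥ 1) := by
        have hT : Aᵀ = A := by simpa [conjTranspose_eq_transpose_of_trivial] using hA.eq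
        conv_lhs => rw [← hone, dotProduct_mulVec, ← mulVec_transpose, hT]
        rw [hb, hA.mulVec_eigenvectorBasis, smul_dotProduct, smul_eq_mul]
      have h3 : hA.eigenvalues i ≠ 1 := fun h => by rw [h] at h1; norm_num at h1
      have h4 : (1 - hA.eigenvalues i) * (b i ⬝ᵥ 1) = 0 := by linarith
      exact (mul_eq_zero.1 h4).resolve_left (sub_ne_zero.2 h3.symm)
    have hz : (WithLp.toLp 2 (1 : Fin N → ℝ)) = 0 := by
      refine InnerProductSpace.ext_inner_left_basis (𝕜 := ℝ) hA.eigenvectorBasis.toBasis fun i => ?_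
      have := horth i
      simp only [OrthonormalBasis.coe_toBasis, inner_zero_right]
      rw [EuclideanSpace.inner_eq_star_dotProduct, dotProduct_comm]
      simpa using this
    have := congrArg (fun v : EuclideanSpace ℝ (Fin N) => v ⟨0, hN⟩) hz
    simp at this
  obtain ⟨i₀, hi₀⟩ := hex
  obtain ⟨e, he⟩ := exists_eigenvalues_eq_eig hA
  have hother : ∀ i, i ≠ i₀ → |hA.eigenvalues i| < 1 := fun i hi =>
    hnc i fun h => hi (huniq _ _ h hi₀)
  have htop : e ⟨0, hN⟩ = i₀ := by
    by_contra hcon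
    have h1 := (abs_lt.1 (hother _ hcon)).2
    have h2 := he (e.symm i₀)
    rw [Equiv.apply_symm_apply, hc i₀ hi₀] at h2
    rw [he] at h1
    have h3 : eig hA (e.symm i₀ + 1) ≤ eig hA 1 :=
      eig_le_eig hA le_rfl (by omega) (by omega)
    simp only [zero_add] at h1
    linarith
  refine ⟨?_, fun i hi => ?_⟩
  · have := he ⟨0, hN⟩
    rw [htop, hc i₀ hi₀] at this
    simpa using this.symm
  · rw [Finset.mem_Icc] at hi
    have h1 := he ⟨i - 1, by omega⟩
    simp only [Nat.sub_add_cancel (by omega : 1 ≤ i)] at h1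
    rw [← h1]
    refine hother _ fun h => ?_
    rw [← htop] at h
    have := congrArg Fin.val (e.injective h)
    simp only at this
    omega

lemma trace_pow_sub_one {N : ℕ} (hN : 0 < N) {A : Matrix (Fin N) (Fin N) ℝ} (hA : A.IsHermitian)
    (h1 : eig hA 1 = 1) (k : ℕ) :
    (A ^ k).trace - 1 = ∑ i ∈ Finset.Icc 2 N, eig hA i ^ k := by
  rw [trace_pow_eq_sum_eigenvalues hA, sum_eigenvalues_eq_sum_eig hA (fun x => x ^ k),
    ← Finset.add_sum_Ioc_eq_sum_Icc (by omega : 1 ≤ N), h1, one_pow, add_sub_cancel_left]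
  rfl

/-- The Dirichlet form of a symmetric stochastic matrix. -/
lemma dotProduct_self_sub_dotProduct_mulVec {m : Type*} [Fintype m] [DecidableEq m]
    {A : Matrix m m ℝ} (hS : A.IsSymm) (hone : A *ᵥ 1 = 1) (u : m → ℝ) :
    u ⬝ᵥ u - u ⬝ᵥ A *ᵥ u = 1 / 2 * ∑ i, ∑ j, A i j * (u i - u j) ^ 2 := by
  have hrow : ∀ i, ∑ j, A i j = 1 := fun i => by
    have := congrFun hone i
    simpa [mulVec, dotProduct] using this
  have hcol : ∀ j, ∑ i, A i j = 1 := fun j => by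
    rw [← hrow j]; exact Finset.sum_congr rfl fun i _ => hS.apply j i
  have e1 : ∑ i, ∑ j, A i j * u i ^ 2 = u ⬝ᵥ u := by
    simp only [dotProduct, ← Finset.sum_mul, hrow]
    exact Finset.sum_congr rfl fun i _ => by ring
  have e2 : ∑ i, ∑ j, A i j * u j ^ 2 = u ⬝ᵥ u := by
    rw [Finset.sum_comm]
    simp only [dotProduct, ← Finset.sum_mul, hcol]
    exact Finset.sum_congr rfl fun i _ => by ring
  have e3 : ∑ i, ∑ j, A i j * (u i * u j) = u ⬝ᵥ A *ᵥ u := by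
    simp only [dotProduct, mulVec, Finset.mul_sum]
    exact Finset.sum_congr rfl fun i _ => Finset.sum_congr rfl fun j _ => by ring
  have : ∑ i, ∑ j, A i j * (u i - u j) ^ 2 = ∑ i, ∑ j, A i j * u i ^ 2 +
      ∑ i, ∑ j, A i j * u j ^ 2 - 2 * ∑ i, ∑ j, A i j * (u i * u j) := by
    simp only [Finset.mul_sum, ← Finset.sum_add_distrib, ← Finset.sum_sub_distrib]
    exact Finset.sum_congr rfl fun i _ => Finset.sum_congr rfl fun j _ => by ring
  rw [this, e1, e2, e3]
  ring

lemma dotProduct_mulVec_lt {N : ℕ} {A : Matrix (Fin N) (Fin N) ℝ} (hS : A.IsSymm)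
    (hone : A *ᵥ 1 = 1) (hnn : ∀ i j, 0 ≤ A i j) (hreach : HasGloballyReachableNode A)
    (u : Fin N → ℝ) (hu : ¬ ∃ c : ℝ, u = c • 1) : u ⬝ᵥ A *ᵥ u < u ⬝ᵥ u := by
  have hD := dotProduct_self_sub_dotProduct_mulVec hS hone u
  have hterm : ∀ i j, 0 ≤ A i j * (u i - u j) ^ 2 := fun i j =>
    mul_nonneg (hnn i j) (sq_nonneg _)
  by_contra hcon
  have hzero : ∑ i, ∑ j, A i j * (u i - u j) ^ 2 = 0 :=
    le_antisymm (by linarith) (Finset.sum_nonneg fun i _ => Finset.sum_nonneg fun j _ => hterm i j)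
  have hz : ∀ i j, A i j * (u i - u j) ^ 2 = 0 := fun i j => by
    have h1 := (Finset.sum_eq_zero_iff_of_nonneg
      (fun i _ => Finset.sum_nonneg fun j _ => hterm i j)).1 hzero i (Finset.mem_univ i)
    exact (Finset.sum_eq_zero_iff_of_nonneg (fun j _ => hterm i j)).1 h1 j (Finset.mem_univ j)
  obtain ⟨v, hv⟩ := hreach
  refine hu ⟨u v, funext fun i => ?_⟩
  have : u i = u v := by
    induction hv i using Relation.ReflTransGen.head_induction_on with
    | refl => rfl
    | head h _ ih =>
      have := (mul_eq_zero.1 (hz _ _)).resolve_left h.ne'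
      rw [← ih]
      exact sub_eq_zero.1 (pow_eq_zero_iff two_ne_zero |>.1 this)
  simpa using this

/-! ### Powers of a completely positive symmetric map -/

/-- Moving a factor `A` from the right to the left of the pairing defined by `K` increases it: in the
eigenbasis of `A`, with weights `w i j = w j i ≥ 0`, this is
`∑ w i j * (α i ^ a - α j ^ a) * (α i - α j) ≥ 0`. -/
lemma vec_pow_dotProduct_mulVec_vec_le {m : Type*} [Fintype m] [DecidableEq m] {A : Matrix m m ℝ}
    (hA : A.IsHermitian) (hnn : ∀ i, 0 ≤ hA.eigenvalues i) {K : Matrix (m × m) (m × m) ℝ}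
    (hK : K.IsSymm)
    (hpos : ∀ u v : m → ℝ, 0 ≤ vec (vecMulVec u u) ⬝ᵥ K *ᵥ vec (vecMulVec v v)) (a : ℕ) :
    vec (A ^ a) ⬝ᵥ K *ᵥ vec A ≤ vec (A ^ (a + 1)) ⬝ᵥ K *ᵥ vec 1 := by
  set w : m → m → ℝ := fun i j =>
    vec (vecMulVec (hA.eigenvectorBasis i).ofLp (hA.eigenvectorBasis i).ofLp) ⬝ᵥ
      K *ᵥ vec (vecMulVec (hA.eigenvectorBasis j).ofLp (hA.eigenvectorBasis j).ofLp) with hw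
  have hexp : ∀ b c, vec (A ^ b) ⬝ᵥ K *ᵥ vec (A ^ c) =
      ∑ i, ∑ j, hA.eigenvalues i ^ b * hA.eigenvalues j ^ c * w i j := by
    intro b c
    rw [pow_eq_sum_smul_vecMulVec hA b, pow_eq_sum_smul_vecMulVec hA c]
    simp only [vec_sum, vec_smul, mulVec_sum, mulVec_smul, sum_dotProduct, dotProduct_sum,
      smul_dotProduct, dotProduct_smul, smul_eq_mul, hw, Finset.mul_sum]
    rw [Finset.sum_comm]
    exact Finset.sum_congr rfl fun i _ => Finset.sum_congr rfl fun j _ => by ring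
  have hsymm : ∀ i j, w i j = w j i := fun i j => by
    simp only [hw]
    rw [dotProduct_mulVec, dotProduct_comm, ← mulVec_transpose, hK]
  have hwn : ∀ i j, 0 ≤ w i j := fun i j => hpos _ _
  have e1 := hexp a 1
  have e2 := hexp (a + 1) 0
  rw [pow_one] at e1
  rw [pow_zero] at e2
  rw [e1, e2]
  have hswap : ∀ b c, ∑ i, ∑ j, hA.eigenvalues i ^ b * hA.eigenvalues j ^ c * w i j =
      ∑ i, ∑ j, hA.eigenvalues i ^ c * hA.eigenvalues j ^ b * w i j := fun b c => by
    rw [Finset.sum_comm]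
    exact Finset.sum_congr rfl fun i _ => Finset.sum_congr rfl fun j _ => by
      rw [hsymm j i]; ring
  have hmono : ∀ x y : ℝ, 0 ≤ x → 0 ≤ y → 0 ≤ (x ^ a - y ^ a) * (x - y) := by
    intro x y hx hy
    rcases le_total x y with h | h
    · exact mul_nonneg_of_nonpos_of_nonpos (sub_nonpos.2 (pow_le_pow_left₀ hx h a))
        (sub_nonpos.2 h)
    · exact mul_nonneg (sub_nonneg.2 (pow_le_pow_left₀ hy h a)) (sub_nonneg.2 h)
  have hpos2 : 0 ≤ ∑ i, ∑ j, ((hA.eigenvalues i ^ a - hA.eigenvalues j ^ a) *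
      (hA.eigenvalues i - hA.eigenvalues j)) * w i j :=
    Finset.sum_nonneg fun i _ => Finset.sum_nonneg fun j _ =>
      mul_nonneg (hmono _ _ (hnn i) (hnn j)) (hwn i j)
  have hsplit : ∑ i, ∑ j, ((hA.eigenvalues i ^ a - hA.eigenvalues j ^ a) *
      (hA.eigenvalues i - hA.eigenvalues j)) * w i j =
      ∑ i, ∑ j, hA.eigenvalues i ^ (a + 1) * hA.eigenvalues j ^ 0 * w i j +
      ∑ i, ∑ j, hA.eigenvalues i ^ 0 * hA.eigenvalues j ^ (a + 1) * w i j -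
      ∑ i, ∑ j, hA.eigenvalues i ^ a * hA.eigenvalues j ^ 1 * w i j -
      ∑ i, ∑ j, hA.eigenvalues i ^ 1 * hA.eigenvalues j ^ a * w i j := by
    simp only [← Finset.sum_add_distrib, ← Finset.sum_sub_distrib]
    exact Finset.sum_congr rfl fun i _ => Finset.sum_congr rfl fun j _ => by ring
  rw [hsplit, hswap 0 (a + 1), hswap 1 a] at hpos2
  linarith

/-- If `K` sends `vec 1` to `vec A`, then `vec 1 ⬝ᵥ K ^ k *ᵥ vec 1` is at most the trace
of `A ^ k`. -/
lemma vec_one_dotProduct_pow_mulVec_vec_one_le {m : Type*} [Fintype m] [DecidableEq m]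
    {A : Matrix m m ℝ} (hA : A.IsHermitian) (hnn : ∀ i, 0 ≤ hA.eigenvalues i)
    {K : Matrix (m × m) (m × m) ℝ} (hK : K.IsSymm)
    (hpos : ∀ (j : ℕ) (u v : m → ℝ),
      0 ≤ vec (vecMulVec u u) ⬝ᵥ (K ^ j) *ᵥ vec (vecMulVec v v))
    (hKA : K *ᵥ vec 1 = vec A) (k : ℕ) :
    vec (1 : Matrix m m ℝ) ⬝ᵥ (K ^ k) *ᵥ vec 1 ≤ (A ^ k).trace := by
  have key : ∀ j a : ℕ, vec (A ^ a) ⬝ᵥ (K ^ j) *ᵥ vec 1 ≤ (A ^ (a + j)).trace := by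
    intro j
    induction j with
    | zero =>
      intro a
      rw [pow_zero, one_mulVec, vec_dotProduct_vec, mul_one, trace_transpose, add_zero]
    | succ j ih =>
      intro a
      rw [pow_succ, ← mulVec_mulVec, hKA]
      refine (vec_pow_dotProduct_mulVec_vec_le hA hnn (K := K ^ j) (hK.pow j) (hpos j) a).trans ?_
      refine (ih (a + 1)).trans_eq ?_
      rw [add_right_comm, add_assoc]
  simpa using key k 0

/-! ### Products of random matrices -/

lemma measurable_matrix_iff {α : Type*} [MeasurableSpace α] {N : ℕ}
    {f : α → Matrix (Fin N) (Fin N) ℝ} :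
    Measurable f ↔ ∀ i j, Measurable fun x => f x i j := by
  have : Measurable f ↔ ∀ i, Measurable fun x => (f x : Fin N → Fin N → ℝ) i :=
    measurable_pi_iff
  rw [this]
  exact forall_congr' fun i => measurable_pi_iff

lemma measurable_apply_apply {N : ℕ} (i j : Fin N) :
    Measurable fun X : Matrix (Fin N) (Fin N) ℝ => X i j :=
  measurable_matrix_iff.1 measurable_id i j

/-- The product `p (s + k - 1) * ⋯ * p (s + 1) * p s`, which carries the state at time `s` to the
state at time `s + k` when there is no noise. -/
def transition {N : ℕ} (p : ℕ → Matrix (Fin N) (Fin N) ℝ) (s : ℕ) :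
    ℕ → Matrix (Fin N) (Fin N) ℝ
  | 0 => 1
  | k + 1 => p (s + k) * transition p s k

lemma measurable_transition {N : ℕ} (s k : ℕ) :
    Measurable fun p : ℕ → Matrix (Fin N) (Fin N) ℝ => transition p s k := by
  induction k with
  | zero => exact measurable_const
  | succ k ih =>
    refine measurable_matrix_iff.2 fun i j => ?_
    simp only [transition, Matrix.mul_apply]
    exact Finset.measurable_sum _ fun c _ =>
      ((measurable_apply_apply i c).comp (measurable_pi_apply (s + k))).mul
        (measurable_matrix_iff.1 ih c j)

lemma transition_congr {N : ℕ} {p q : ℕ → Matrix (Fin N) (Fin N) ℝ} (s k : ℕ)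
    (h : ∀ i < s + k, p i = q i) : transition p s k = transition q s k := by
  induction k with
  | zero => rfl
  | succ k ih =>
    rw [transition, transition, h (s + k) (by omega), ih fun i hi => h i (by omega)]

lemma transition_mem_rowStochastic {N : ℕ} {p : ℕ → Matrix (Fin N) (Fin N) ℝ}
    (h : ∀ t, p t ∈ rowStochastic ℝ (Fin N)) (s k : ℕ) :
    transition p s k ∈ rowStochastic ℝ (Fin N) := by
  induction k with
  | zero => exact one_mem _
  | succ k ih => exact mul_mem (h _) ih

lemma transition_mem_colStochastic {N : ℕ} {p : ℕ → Matrix (Fin N) (Fin N) ℝ}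
    (h : ∀ t, p t ∈ colStochastic ℝ (Fin N)) (s k : ℕ) :
    transition p s k ∈ colStochastic ℝ (Fin N) := by
  induction k with
  | zero => exact one_mem _
  | succ k ih => exact mul_mem (h _) ih

lemma IsSymm.mem_colStochastic {N : ℕ} {A : Matrix (Fin N) (Fin N) ℝ} (hS : A.IsSymm)
    (h : A ∈ rowStochastic ℝ (Fin N)) : A ∈ colStochastic ℝ (Fin N) := by
  rw [← hS.eq]
  exact transpose_mem_colStochastic_iff_mem_rowStochastic.2 h

/-- A sequence of i.i.d. random matrices, almost surely symmetric and stochastic. -/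
structure IsIIDSymmStochastic {Ω : Type*} [MeasurableSpace Ω] (μ : Measure Ω) {N : ℕ}
    (P : ℕ → Ω → Matrix (Fin N) (Fin N) ℝ) : Prop where
  measurable : ∀ t, Measurable (P t)
  indep : iIndepFun P μ
  ident : ∀ t, IdentDistrib (P t) (P 0) μ μ
  stoch : ∀ᵐ ω ∂μ, ∀ t, P t ω ∈ rowStochastic ℝ (Fin N)
  symm : ∀ᵐ ω ∂μ, ∀ t, (P t ω).IsSymm

namespace IsIIDSymmStochastic

variable {Ω : Type*} [MeasurableSpace Ω] {μ : Measure Ω} {N : ℕ}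
  {P : ℕ → Ω → Matrix (Fin N) (Fin N) ℝ}

lemma measurable_transition (hP : IsIIDSymmStochastic μ P) (s k : ℕ) :
    Measurable fun ω => transition (fun t => P t ω) s k :=
  (NoisyConsensus.measurable_transition s k).comp (measurable_pi_lambda _ hP.measurable)

lemma indepFun_transition (hP : IsIIDSymmStochastic μ P) (s k : ℕ) :
    IndepFun (P (s + k)) (fun ω => transition (fun t => P t ω) s k) μ := by
  have h := hP.indep.indepFun_finset {s + k} (Finset.range (s + k)) (by simp) hP.measurable
  set φ : ((i : ({s + k} : Finset ℕ)) → Matrix (Fin N) (Fin N) ℝ) → Matrix (Fin N) (Fin N) ℝ :=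
    fun g => g ⟨s + k, Finset.mem_singleton_self _⟩ with hφ
  set ψ : ((i : Finset.range (s + k)) → Matrix (Fin N) (Fin N) ℝ) → Matrix (Fin N) (Fin N) ℝ :=
    fun g => transition (fun i => if h : i ∈ Finset.range (s + k) then g ⟨i, h⟩ else 1) s k with hψ
  have hφm : Measurable φ := measurable_pi_apply _
  have hψm : Measurable ψ := by
    refine (NoisyConsensus.measurable_transition s k).comp (measurable_pi_lambda _ fun i => ?_)
    by_cases hi : i ∈ Finset.range (s + k)
    · simp only [hi, dif_pos]; exact measurable_pi_apply _
    · simp only [hi, dif_neg, not_false_eq_true]; exact measurable_const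
  have h2 := h.comp hφm hψm
  have h3 : (fun ω => transition (fun t => P t ω) s k) =
      ψ ∘ fun ω (i : Finset.range (s + k)) => P i ω := by
    funext ω
    refine transition_congr s k fun i hi => ?_
    simp [hi]
  rw [h3]
  exact h2

lemma integral_map_apply (hP : IsIIDSymmStochastic μ P)
    {f : Matrix (Fin N) (Fin N) ℝ → ℝ} (hf : Measurable f) (t : ℕ) :
    ∫ ω, f (P t ω) ∂μ = ∫ ω, f (P 0 ω) ∂μ :=
  ((hP.ident t).comp hf).integral_eq

/-- The expectation of a multiplicative function of a product of i.i.d. stochastic matrices is a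
power of a single expectation. -/
lemma integral_monoidHom_transition [IsProbabilityMeasure μ] (hP : IsIIDSymmStochastic μ P)
    {m : Type*} [Fintype m] [DecidableEq m]
    (ρ : Matrix (Fin N) (Fin N) ℝ →* Matrix m m ℝ)
    (hρ : ∀ i j, Measurable fun X => ρ X i j)
    (hbdd : ∀ X ∈ rowStochastic ℝ (Fin N), ∀ i j, |ρ X i j| ≤ 1) (s k : ℕ) (i j : m) :
    ∫ ω, ρ (transition (fun t => P t ω) s k) i j ∂μ =
      ((Matrix.of fun i j => ∫ ω, ρ (P 0 ω) i j ∂μ) ^ k) i j := by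
  induction k generalizing i with
  | zero => simp [transition]
  | succ k ih =>
    have hind : ∀ c, IndepFun (fun ω => ρ (P (s + k) ω) i c)
        (fun ω => ρ (transition (fun t => P t ω) s k) c j) μ := fun c =>
      (hP.indepFun_transition s k).comp (hρ i c) (hρ c j)
    have hm1 : ∀ c, Measurable fun ω => ρ (P (s + k) ω) i c := fun c =>
      (hρ i c).comp (hP.measurable _)
    have hm2 : ∀ c, Measurable fun ω => ρ (transition (fun t => P t ω) s k) c j := fun c =>
      (hρ c j).comp (hP.measurable_transition s k)
    have hi1 : ∀ c, Integrable (fun ω => ρ (P (s + k) ω) i c) μ := fun c =>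
      Integrable.of_bound (hm1 c).aestronglyMeasurable 1 (by
        filter_upwards [hP.stoch] with ω hω
        exact hbdd _ (hω _) _ _)
    have hi2 : ∀ c, Integrable (fun ω => ρ (transition (fun t => P t ω) s k) c j) μ := fun c =>
      Integrable.of_bound (hm2 c).aestronglyMeasurable 1 (by
        filter_upwards [hP.stoch] with ω hω
        exact hbdd _ (transition_mem_rowStochastic hω _ _) _ _)
    simp only [transition, map_mul, Matrix.mul_apply]
    have hint : ∀ c, Integrable (fun ω => ρ (P (s + k) ω) i c *
        ρ (transition (fun t => P t ω) s k) c j) μ := fun c =>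
      (hind c).integrable_mul (hi1 c) (hi2 c)
    rw [integral_finsetSum _ fun c _ => hint c, pow_succ', Matrix.mul_apply]
    refine Finset.sum_congr rfl fun c _ => ?_
    rw [(hind c).integral_fun_mul_eq_mul_integral (hm1 c).aestronglyMeasurable
      (hm2 c).aestronglyMeasurable, ih c]
    congr 1
    exact hP.integral_map_apply (hρ i c) (s + k)

end IsIIDSymmStochastic

/-- The matrix `𝔼[A ⊗ A]`, which represents the linear map `X ↦ 𝔼[A X Aᵀ]` on vectorized
matrices. -/
noncomputable def secondMoment {Ω : Type*} [MeasurableSpace Ω] (μ : Measure Ω) {N : ℕ}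
    (A : Ω → Matrix (Fin N) (Fin N) ℝ) : Matrix (Fin N × Fin N) (Fin N × Fin N) ℝ :=
  Matrix.of fun i j => ∫ ω, (A ω ⊗ₖ A ω) i j ∂μ

/-- The homomorphism `A ↦ A ⊗ A`. -/
def kroneckerSelf (N : ℕ) :
    Matrix (Fin N) (Fin N) ℝ →* Matrix (Fin N × Fin N) (Fin N × Fin N) ℝ where
  toFun A := A ⊗ₖ A
  map_one' := one_kronecker_one
  map_mul' A B := mul_kronecker_mul A B A B

lemma abs_apply_le_one {N : ℕ} {X : Matrix (Fin N) (Fin N) ℝ} (hX : X ∈ rowStochastic ℝ (Fin N))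
    (i j : Fin N) : |X i j| ≤ 1 := by
  rw [abs_of_nonneg (nonneg_of_mem_rowStochastic hX)]
  exact le_one_of_mem_rowStochastic hX

lemma sq_integral_le {Ω : Type*} [MeasurableSpace Ω] {μ : Measure Ω} [IsProbabilityMeasure μ]
    {f : Ω → ℝ} (hf : MemLp f 2 μ) : (∫ ω, f ω ∂μ) ^ 2 ≤ ∫ ω, f ω ^ 2 ∂μ := by
  have h := variance_nonneg f μ
  rw [variance_eq_sub hf] at h
  simpa using h

namespace IsIIDSymmStochastic

variable {Ω : Type*} [MeasurableSpace Ω] {μ : Measure Ω} {N : ℕ}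
  {P : ℕ → Ω → Matrix (Fin N) (Fin N) ℝ}

lemma memLp_apply [IsProbabilityMeasure μ] (hP : IsIIDSymmStochastic μ P) (t : ℕ) (i j : Fin N)
    (r : ENNReal) : MemLp (fun ω => P t ω i j) r μ :=
  MemLp.of_bound ((measurable_matrix_iff.1 (hP.measurable t) i j).aestronglyMeasurable) 1 (by
    filter_upwards [hP.stoch] with ω hω
    exact abs_apply_le_one (hω t) i j)

lemma memLp_transition_apply [IsProbabilityMeasure μ] (hP : IsIIDSymmStochastic μ P) (s k : ℕ)
    (i j : Fin N) (r : ENNReal) :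
    MemLp (fun ω => transition (fun t => P t ω) s k i j) r μ :=
  MemLp.of_bound
    ((measurable_matrix_iff.1 (hP.measurable_transition s k) i j).aestronglyMeasurable) 1 (by
    filter_upwards [hP.stoch] with ω hω
    exact abs_apply_le_one (transition_mem_rowStochastic hω s k) i j)

lemma integrable_mul_apply [IsProbabilityMeasure μ] (hP : IsIIDSymmStochastic μ P) (t : ℕ)
    (i j k l : Fin N) : Integrable (fun ω => P t ω i j * P t ω k l) μ :=
  (hP.memLp_apply t i j 2).integrable_mul (hP.memLp_apply t k l 2)

lemma integral_transition [IsProbabilityMeasure μ] (hP : IsIIDSymmStochastic μ P) (s k : ℕ)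
    (i j : Fin N) :
    ∫ ω, transition (fun t => P t ω) s k i j ∂μ = (expMatrix μ (P 0) ^ k) i j :=
  hP.integral_monoidHom_transition (MonoidHom.id _) measurable_apply_apply
    (fun _ hX i j => abs_apply_le_one hX i j) s k i j

lemma integral_transition_mul_transition [IsProbabilityMeasure μ] (hP : IsIIDSymmStochastic μ P)
    (s k : ℕ) (i j : Fin N × Fin N) :
    ∫ ω, transition (fun t => P t ω) s k i.1 j.1 * transition (fun t => P t ω) s k i.2 j.2 ∂μ =
      (secondMoment μ (P 0) ^ k) i j := by
  refine hP.integral_monoidHom_transition (kroneckerSelf N) (fun i j => ?_) (fun X hX i j => ?_)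
    s k i j
  · exact (measurable_apply_apply i.1 j.1).mul (measurable_apply_apply i.2 j.2)
  · change |X i.1 j.1 * X i.2 j.2| ≤ 1
    rw [abs_mul]
    exact mul_le_one₀ (abs_apply_le_one hX _ _) (abs_nonneg _) (abs_apply_le_one hX _ _)

/-- The powers of `𝔼[P ⊗ P]` are the second moments of the products. -/
lemma vec_dotProduct_secondMoment_pow [IsProbabilityMeasure μ] (hP : IsIIDSymmStochastic μ P)
    (s k : ℕ) (X Y : Matrix (Fin N) (Fin N) ℝ) :
    vec X ⬝ᵥ (secondMoment μ (P 0) ^ k) *ᵥ vec Y =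
      ∫ ω, (Xᵀ * (transition (fun t => P t ω) s k * Y *
        (transition (fun t => P t ω) s k)ᵀ)).trace ∂μ := by
  have h : ∀ ω, (Xᵀ * (transition (fun t => P t ω) s k * Y *
      (transition (fun t => P t ω) s k)ᵀ)).trace =
      ∑ i, ∑ j, vec X i * ((transition (fun t => P t ω) s k i.1 j.1 *
        transition (fun t => P t ω) s k i.2 j.2) * vec Y j) := fun ω => by
    rw [← vec_dotProduct_vec, ← kronecker_mulVec_vec]
    simp only [dotProduct, mulVec, Finset.mul_sum, kroneckerMap_apply]
  have hint : ∀ i j : Fin N × Fin N, Integrable (fun ω => vec X i *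
      ((transition (fun t => P t ω) s k i.1 j.1 *
        transition (fun t => P t ω) s k i.2 j.2) * vec Y j)) μ := fun i j =>
    (((hP.memLp_transition_apply s k i.1 j.1 2).integrable_mul
      (hP.memLp_transition_apply s k i.2 j.2 2)).mul_const _).const_mul _
  simp only [h]
  rw [integral_finsetSum _ fun i _ => integrable_finsetSum _ fun j _ => hint i j]
  simp only [dotProduct, mulVec, Finset.mul_sum]
  refine Finset.sum_congr rfl fun i _ => ?_
  rw [integral_finsetSum _ fun j _ => hint i j]
  refine Finset.sum_congr rfl fun j _ => ?_
  rw [integral_const_mul, integral_mul_const, hP.integral_transition_mul_transition]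

lemma vec_dotProduct_secondMoment_pow_nonneg [IsProbabilityMeasure μ]
    (hP : IsIIDSymmStochastic μ P) (k : ℕ) (u v : Fin N → ℝ) :
    0 ≤ vec (vecMulVec u u) ⬝ᵥ (secondMoment μ (P 0) ^ k) *ᵥ vec (vecMulVec v v) := by
  rw [hP.vec_dotProduct_secondMoment_pow 0 k]
  refine integral_nonneg fun ω => ?_
  simp only [Pi.zero_apply]
  rw [mul_vecMulVec, vecMulVec_mul, vecMul_transpose, transpose_vecMulVec, vecMulVec_mul_vecMulVec,
    trace_vecMulVec, dotProduct_smul, smul_eq_mul]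
  exact mul_self_nonneg _

lemma secondMoment_isSymm (hP : IsIIDSymmStochastic μ P) : (secondMoment μ (P 0)).IsSymm := by
  refine IsSymm.ext fun i j => integral_congr_ae ?_
  filter_upwards [hP.symm] with ω hω
  rw [kroneckerMap_apply, kroneckerMap_apply, (hω 0).apply i.1 j.1, (hω 0).apply i.2 j.2]

lemma expMatrix_isSymm (hP : IsIIDSymmStochastic μ P) : (expMatrix μ (P 0)).IsSymm := by
  refine IsSymm.ext fun i j => integral_congr_ae ?_
  filter_upwards [hP.symm] with ω hω
  exact (hω 0).apply i j

lemma expMatrix_sq_isSymm (hP : IsIIDSymmStochastic μ P) :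
    (expMatrix μ fun ω => P 0 ω ^ 2).IsSymm := by
  refine IsSymm.ext fun i j => integral_congr_ae ?_
  filter_upwards [hP.symm] with ω hω
  exact ((hω 0).pow 2).apply i j

lemma secondMoment_mulVec_vec_one [IsProbabilityMeasure μ] (hP : IsIIDSymmStochastic μ P) :
    secondMoment μ (P 0) *ᵥ vec 1 = vec (expMatrix μ fun ω => P 0 ω ^ 2) := by
  funext ⟨a, b⟩
  have h1 : (secondMoment μ (P 0) *ᵥ vec 1) (a, b) = ∑ c, ∫ ω, P 0 ω a c * P 0 ω b c ∂μ := by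
    simp [mulVec, dotProduct, Fintype.sum_prod_type, vec, Matrix.one_apply, secondMoment]
  rw [h1, ← integral_finsetSum _ fun c _ => hP.integrable_mul_apply 0 a c b c]
  refine integral_congr_ae ?_
  filter_upwards [hP.symm] with ω hω
  simp only [pow_two, Matrix.mul_apply]
  exact Finset.sum_congr rfl fun c _ => by rw [(hω 0).apply a c]; ring

/-! ### The expectations of the update matrix and of its square -/

lemma expMatrix_mulVec_one [IsProbabilityMeasure μ] (hP : IsIIDSymmStochastic μ P) :
    expMatrix μ (P 0) *ᵥ 1 = 1 := by
  funext i
  simp only [mulVec, dotProduct, expMatrix, of_apply, Pi.one_apply, mul_one]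
  rw [← integral_finsetSum _ fun c _ => (hP.memLp_apply 0 i c 1).integrable le_rfl]
  rw [integral_congr_ae (g := fun _ => (1 : ℝ))]
  · simp
  · filter_upwards [hP.stoch] with ω hω
    exact sum_row_of_mem_rowStochastic (hω 0) i

lemma integrable_sq_apply [IsProbabilityMeasure μ] (hP : IsIIDSymmStochastic μ P) (i j : Fin N) :
    Integrable (fun ω => (P 0 ω ^ 2) i j) μ := by
  simp only [pow_two, Matrix.mul_apply]
  exact integrable_finsetSum _ fun c _ => hP.integrable_mul_apply 0 i c c j

lemma expMatrix_sq_mulVec_one [IsProbabilityMeasure μ] (hP : IsIIDSymmStochastic μ P) :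
    (expMatrix μ fun ω => P 0 ω ^ 2) *ᵥ 1 = 1 := by
  funext i
  simp only [mulVec, dotProduct, expMatrix, of_apply, Pi.one_apply, mul_one]
  rw [← integral_finsetSum _ fun c _ => hP.integrable_sq_apply i c]
  rw [integral_congr_ae (g := fun _ => (1 : ℝ))]
  · simp
  · filter_upwards [hP.stoch] with ω hω
    exact sum_row_of_mem_rowStochastic (pow_mem (hω 0) 2) i

lemma expMatrix_sq_nonneg (hP : IsIIDSymmStochastic μ P) (i j : Fin N) :
    0 ≤ expMatrix μ (fun ω => P 0 ω ^ 2) i j := by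
  refine integral_nonneg_of_ae ?_
  filter_upwards [hP.stoch] with ω hω
  exact nonneg_of_mem_rowStochastic (pow_mem (hω 0) 2)

/-- Positive diagonals make every edge of the graph of `𝔼[P]` an edge of the graph of `𝔼[P ^ 2]`,
since `(P ^ 2) i j ≥ P i i * P i j`. -/
lemma expMatrix_sq_pos [IsProbabilityMeasure μ] (hP : IsIIDSymmStochastic μ P)
    (hdiag : ∀ᵐ ω ∂μ, ∀ i, 0 < P 0 ω i i) {i j : Fin N} (hij : 0 < expMatrix μ (P 0) i j) :
    0 < expMatrix μ (fun ω => P 0 ω ^ 2) i j := by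
  refine lt_of_le_of_ne (hP.expMatrix_sq_nonneg i j) fun h0 => hij.ne' ?_
  have hz : (fun ω => (P 0 ω ^ 2) i j) =ᵐ[μ] 0 := by
    refine (integral_eq_zero_iff_of_nonneg_ae ?_ (hP.integrable_sq_apply i j)).1 h0.symm
    filter_upwards [hP.stoch] with ω hω
    exact nonneg_of_mem_rowStochastic (pow_mem (hω 0) 2)
  refine integral_eq_zero_of_ae ?_
  filter_upwards [hz, hP.stoch, hdiag] with ω h1 hω hd
  have hle : P 0 ω i i * P 0 ω i j ≤ (P 0 ω ^ 2) i j := by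
    rw [pow_two, Matrix.mul_apply]
    exact Finset.single_le_sum (f := fun c => P 0 ω i c * P 0 ω c j) (fun c _ => mul_nonneg
      (nonneg_of_mem_rowStochastic (hω 0)) (nonneg_of_mem_rowStochastic (hω 0)))
      (Finset.mem_univ i)
  rw [h1] at hle
  have hnn : 0 ≤ P 0 ω i j := nonneg_of_mem_rowStochastic (hω 0)
  exact le_antisymm (nonpos_of_mul_nonpos_right hle (hd i)) hnn

lemma dotProduct_expMatrix_sq_mulVec [IsProbabilityMeasure μ] (hP : IsIIDSymmStochastic μ P)
    (u : Fin N → ℝ) :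
    u ⬝ᵥ (expMatrix μ fun ω => P 0 ω ^ 2) *ᵥ u = ∑ i, ∫ ω, (P 0 ω *ᵥ u) i ^ 2 ∂μ := by
  have hm : ∀ i, MemLp (fun ω => (P 0 ω *ᵥ u) i) 2 μ := fun i => by
    simp only [mulVec, dotProduct]
    exact memLp_finsetSum _ fun j _ => (hP.memLp_apply 0 i j 2).mul_const _
  rw [← integral_finsetSum _ fun i _ => (hm i).integrable_sq]
  have h1 : u ⬝ᵥ (expMatrix μ fun ω => P 0 ω ^ 2) *ᵥ u =
      ∫ ω, ∑ i, ∑ j, u i * ((P 0 ω ^ 2) i j * u j) ∂μ := by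
    have hint : ∀ i j, Integrable (fun ω => u i * ((P 0 ω ^ 2) i j * u j)) μ := fun i j =>
      ((hP.integrable_sq_apply i j).mul_const _).const_mul _
    rw [integral_finsetSum _ fun i _ => integrable_finsetSum _ fun j _ => hint i j]
    simp only [dotProduct, mulVec, Finset.mul_sum]
    refine Finset.sum_congr rfl fun i _ => ?_
    rw [integral_finsetSum _ fun j _ => hint i j]
    refine Finset.sum_congr rfl fun j _ => ?_
    rw [integral_const_mul, integral_mul_const]
    rfl
  rw [h1]
  refine integral_congr_ae ?_
  filter_upwards [hP.symm] with ω hω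
  have h2 : ∑ i, ∑ j, u i * ((P 0 ω ^ 2) i j * u j) = u ⬝ᵥ (P 0 ω ^ 2) *ᵥ u := by
    simp only [dotProduct, mulVec, Finset.mul_sum]
  have h3 : u ⬝ᵥ (P 0 ω ^ 2) *ᵥ u = (P 0 ω *ᵥ u) ⬝ᵥ (P 0 ω *ᵥ u) := by
    rw [pow_two, ← mulVec_mulVec, dotProduct_mulVec, ← mulVec_transpose, hω 0]
  rw [h2, h3]
  exact Finset.sum_congr rfl fun i _ => by ring

lemma dotProduct_expMatrix_mulVec_self_le [IsProbabilityMeasure μ]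
    (hP : IsIIDSymmStochastic μ P) (u : Fin N → ℝ) :
    (expMatrix μ (P 0) *ᵥ u) ⬝ᵥ (expMatrix μ (P 0) *ᵥ u) ≤
      u ⬝ᵥ (expMatrix μ fun ω => P 0 ω ^ 2) *ᵥ u := by
  rw [hP.dotProduct_expMatrix_sq_mulVec]
  refine Finset.sum_le_sum fun i _ => ?_
  have hm : MemLp (fun ω => (P 0 ω *ᵥ u) i) 2 μ := by
    simp only [mulVec, dotProduct]
    exact memLp_finsetSum _ fun j _ => (hP.memLp_apply 0 i j 2).mul_const _
  have he : (expMatrix μ (P 0) *ᵥ u) i = ∫ ω, (P 0 ω *ᵥ u) i ∂μ := by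
    simp only [mulVec, dotProduct]
    rw [integral_finsetSum _ fun j _ =>
      ((hP.memLp_apply 0 i j 1).integrable le_rfl).mul_const _]
    exact Finset.sum_congr rfl fun j _ => by rw [integral_mul_const]; rfl
  rw [he, ← pow_two]
  exact sq_integral_le hm

end IsIIDSymmStochastic

/-! ### The trajectory as a linear function of the noise -/

lemma state_eq {Ω : Type*} {N : ℕ} (P : ℕ → Ω → Matrix (Fin N) (Fin N) ℝ)
    (n : ℕ → Ω → EuclideanSpace ℝ (Fin N)) (x₀ : EuclideanSpace ℝ (Fin N)) (t : ℕ) (ω : Ω) :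
    (state P n x₀ t ω).ofLp = transition (fun t => P t ω) 0 t *ᵥ x₀.ofLp +
      ∑ s ∈ Finset.range t, transition (fun t => P t ω) (s + 1) (t - 1 - s) *ᵥ (n s ω).ofLp := by
  induction t with
  | zero => simp [state, transition]
  | succ t ih =>
    rw [state, WithLp.ofLp_add, ih, mulVec_add, mulVec_mulVec, mulVec_sum, Finset.sum_range_succ,
      add_assoc]
    have h1 : P t ω * transition (fun t => P t ω) 0 t = transition (fun t => P t ω) 0 (t + 1) := by
      rw [transition, zero_add]
    have h2 : transition (fun t => P t ω) (t + 1) (t + 1 - 1 - t) = 1 := by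
      rw [Nat.add_sub_cancel, Nat.sub_self, transition]
    rw [h1, h2, one_mulVec]
    congr 2
    refine Finset.sum_congr rfl fun s hs => ?_
    rw [Finset.mem_range] at hs
    rw [mulVec_mulVec, show t + 1 - 1 - s = (t - 1 - s) + 1 by omega, transition,
      show s + 1 + (t - 1 - s) = t by omega]

lemma deviation_apply {N : ℕ} (x : EuclideanSpace ℝ (Fin N)) (l : Fin N) :
    deviation x l = x l - (N : ℝ)⁻¹ * ∑ i, x i := by
  simp [deviation, mulVec, dotProduct, Finset.mul_sum]

/-- For column-stochastic `M`, subtracting from `M *ᵥ v` its average amounts to subtracting `1 / N`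
from every entry of `M`. -/
lemma mulVec_sub_average {N : ℕ} {M : Matrix (Fin N) (Fin N) ℝ}
    (hM : M ∈ colStochastic ℝ (Fin N)) (v : Fin N → ℝ) (l : Fin N) :
    (M *ᵥ v) l - (N : ℝ)⁻¹ * ∑ i, (M *ᵥ v) i = ∑ i, (M l i - (N : ℝ)⁻¹) * v i := by
  have h : ∑ i, (M *ᵥ v) i = ∑ i, v i := by
    simp only [mulVec, dotProduct]
    rw [Finset.sum_comm]
    refine Finset.sum_congr rfl fun i _ => ?_
    rw [← Finset.sum_mul, sum_col_of_mem_colStochastic hM, one_mul]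
  rw [h]
  simp only [sub_mul, Finset.sum_sub_distrib, ← Finset.mul_sum]
  rfl

/-- For a column-stochastic matrix, the squared Frobenius distance to the averaging matrix. -/
lemma sum_sub_inv_sq {N : ℕ} (hN : 0 < N) {M : Matrix (Fin N) (Fin N) ℝ}
    (hM : M ∈ colStochastic ℝ (Fin N)) :
    ∑ l, ∑ i, (M l i - (N : ℝ)⁻¹) ^ 2 = ∑ l, ∑ i, M l i ^ 2 - 1 := by
  have hN' : (N : ℝ) ≠ 0 := by exact_mod_cast hN.ne'
  have h1 : ∑ l, ∑ i, M l i = (N : ℝ) := by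
    have h : ∑ l, ∑ i, M l i = ∑ i, ∑ l, M l i := Finset.sum_comm
    rw [h]
    simp [sum_col_of_mem_colStochastic hM]
  have h2 : ∑ l, ∑ i, (M l i - (N : ℝ)⁻¹) ^ 2 = ∑ l, ∑ i, M l i ^ 2 -
      2 * (N : ℝ)⁻¹ * (∑ l, ∑ i, M l i) + ∑ _l : Fin N, ∑ _i : Fin N, (N : ℝ)⁻¹ ^ 2 := by
    simp only [Finset.mul_sum, ← Finset.sum_add_distrib, ← Finset.sum_sub_distrib]
    exact Finset.sum_congr rfl fun i _ => Finset.sum_congr rfl fun j _ => by ring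
  rw [h2, h1]
  simp
  field_simp
  ring

/-! ### The variance of the deviation -/

/-- Weighted sums of orthogonal variables, with random weights independent of them. -/
lemma integral_sq_sum_mul {Ω : Type*} [MeasurableSpace Ω] {μ : Measure Ω}
    {ι : Type*} [Fintype ι] {W Z : ι → Ω → ℝ}
    (hW : ∀ a, MemLp (W a) 2 μ) (hZ : ∀ a, MemLp (Z a) 2 μ)
    (hind : IndepFun (fun ω a => W a ω) (fun ω a => Z a ω) μ)
    (horth : ∀ a b, a ≠ b → ∫ ω, Z a ω * Z b ω ∂μ = 0) :
    Integrable (fun ω => (∑ a, W a ω * Z a ω) ^ 2) μ ∧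
      ∫ ω, (∑ a, W a ω * Z a ω) ^ 2 ∂μ = ∑ a, (∫ ω, W a ω ^ 2 ∂μ) * ∫ ω, Z a ω ^ 2 ∂μ := by
  have hexp : ∀ ω, (∑ a, W a ω * Z a ω) ^ 2 =
      ∑ a, ∑ b, (W a ω * W b ω) * (Z a ω * Z b ω) := fun ω => by
    rw [pow_two, Finset.sum_mul_sum]
    exact Finset.sum_congr rfl fun a _ => Finset.sum_congr rfl fun b _ => by ring
  have hi : ∀ a b, IndepFun (fun ω => W a ω * W b ω) (fun ω => Z a ω * Z b ω) μ := fun a b =>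
    hind.comp ((measurable_pi_apply a).mul (measurable_pi_apply b))
      ((measurable_pi_apply a).mul (measurable_pi_apply b))
  have hWW : ∀ a b, Integrable (fun ω => W a ω * W b ω) μ := fun a b =>
    (hW a).integrable_mul (hW b)
  have hZZ : ∀ a b, Integrable (fun ω => Z a ω * Z b ω) μ := fun a b =>
    (hZ a).integrable_mul (hZ b)
  have hint : ∀ a b, Integrable (fun ω => (W a ω * W b ω) * (Z a ω * Z b ω)) μ := fun a b =>
    (hi a b).integrable_mul (hWW a b) (hZZ a b)
  have hint' : ∀ a, Integrable (fun ω => ∑ b, (W a ω * W b ω) * (Z a ω * Z b ω)) μ := fun a =>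
    integrable_finsetSum _ fun b _ => hint a b
  simp only [hexp]
  refine ⟨integrable_finsetSum _ fun a _ => hint' a, ?_⟩
  rw [integral_finsetSum _ fun a _ => hint' a]
  refine Finset.sum_congr rfl fun a _ => ?_
  rw [integral_finsetSum _ fun b _ => hint a b]
  have hval : ∀ b, ∫ ω, (W a ω * W b ω) * (Z a ω * Z b ω) ∂μ =
      (∫ ω, W a ω * W b ω ∂μ) * ∫ ω, Z a ω * Z b ω ∂μ := fun b =>
    (hi a b).integral_fun_mul_eq_mul_integral (hWW a b).aestronglyMeasurable
      (hZZ a b).aestronglyMeasurable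
  rw [Finset.sum_eq_single a (fun b _ hb => by rw [hval, horth a b hb.symm, mul_zero])
    (fun h => absurd (Finset.mem_univ a) h), hval]
  simp only [pow_two]

/-- The expected squared Frobenius distance between a product of `k` update matrices and the
averaging matrix, `𝔼[‖P (k - 1) ⋯ P 0‖²] - 1`. -/
noncomputable def disagreement {Ω : Type*} [MeasurableSpace Ω] (μ : Measure Ω) {N : ℕ}
    (P : ℕ → Ω → Matrix (Fin N) (Fin N) ℝ) (k : ℕ) : ℝ :=
  vec (1 : Matrix (Fin N) (Fin N) ℝ) ⬝ᵥ (secondMoment μ (P 0) ^ k) *ᵥ vec 1 - 1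

namespace IsIIDSymmStochastic

variable {Ω : Type*} [MeasurableSpace Ω] {μ : Measure Ω} {N : ℕ}
  {P : ℕ → Ω → Matrix (Fin N) (Fin N) ℝ}

lemma sum_integral_transition_sq [IsProbabilityMeasure μ] (hP : IsIIDSymmStochastic μ P)
    (s k : ℕ) :
    ∑ l, ∑ i, ∫ ω, transition (fun t => P t ω) s k l i ^ 2 ∂μ = disagreement μ P k + 1 := by
  rw [disagreement, sub_add_cancel, hP.vec_dotProduct_secondMoment_pow s k]
  have hint : ∀ l i, Integrable (fun ω => transition (fun t => P t ω) s k l i ^ 2) μ :=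
    fun l i => (hP.memLp_transition_apply s k l i 2).integrable_sq
  rw [← Finset.sum_congr rfl fun l _ => integral_finsetSum _ fun i _ => hint l i,
    ← integral_finsetSum _ fun l _ => integrable_finsetSum _ fun i _ => hint l i]
  refine integral_congr_ae (Eventually.of_forall fun ω => ?_)
  simp only [transpose_one, Matrix.one_mul, Matrix.mul_one]
  simp only [trace, diag, Matrix.mul_apply, transpose_apply, pow_two]

lemma sum_integral_transition_sub_sq [IsProbabilityMeasure μ] (hP : IsIIDSymmStochastic μ P)
    (hN : 0 < N) (s k : ℕ) :
    ∑ l, ∑ i, ∫ ω, (transition (fun t => P t ω) s k l i - (N : ℝ)⁻¹) ^ 2 ∂μ =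
      disagreement μ P k := by
  have hint : ∀ l i, Integrable (fun ω => transition (fun t => P t ω) s k l i ^ 2) μ :=
    fun l i => (hP.memLp_transition_apply s k l i 2).integrable_sq
  have hint2 : ∀ l i, Integrable
      (fun ω => (transition (fun t => P t ω) s k l i - (N : ℝ)⁻¹) ^ 2) μ :=
    fun l i => ((hP.memLp_transition_apply s k l i 2).sub (memLp_const _)).integrable_sq
  have h := hP.sum_integral_transition_sq s k
  rw [← Finset.sum_congr rfl fun l _ => integral_finsetSum _ fun i _ => hint l i,
    ← integral_finsetSum _ fun l _ => integrable_finsetSum _ fun i _ => hint l i] at h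
  rw [← Finset.sum_congr rfl fun l _ => integral_finsetSum _ fun i _ => hint2 l i,
    ← integral_finsetSum _ fun l _ => integrable_finsetSum _ fun i _ => hint2 l i,
    eq_sub_of_add_eq h.symm]
  have hone : (1 : ℝ) = ∫ _ω, (1 : ℝ) ∂μ := by simp
  conv_rhs => rw [hone]
  rw [← integral_sub (integrable_finsetSum _ fun l _ => integrable_finsetSum _ fun i _ =>
    hint l i) (integrable_const _)]
  refine integral_congr_ae ?_
  filter_upwards [hP.stoch, hP.symm] with ω hω hs
  exact sum_sub_inv_sq hN
    (transition_mem_colStochastic (fun t => IsSymm.mem_colStochastic (hs t) (hω t)) s k)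

/-- The mean squared deviation at time `t` is the sum of a contribution of the initial state, which
is at most `‖x₀‖² * disagreement μ P t`, and of the contributions of the noise at the times
`0, …, t - 1`. -/
lemma integral_norm_deviation_sq [IsProbabilityMeasure μ] (hP : IsIIDSymmStochastic μ P)
    (hN : 0 < N) {σ : ℝ} {n : ℕ → Ω → EuclideanSpace ℝ (Fin N)}
    (hnL2 : ∀ t i, MemLp (fun ω => n t ω i) 2 μ)
    (hnmean : ∀ t i, ∫ ω, n t ω i ∂μ = 0)
    (hnsq : ∀ t i, ∫ ω, n t ω i ^ 2 ∂μ = σ ^ 2)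
    (hnorth : ∀ t i s j, (t, i) ≠ (s, j) → ∫ ω, n t ω i * n s ω j ∂μ = 0)
    (hnP : IndepFun (fun ω t => P t ω) (fun ω t => n t ω) μ)
    (x₀ : EuclideanSpace ℝ (Fin N)) (t : ℕ) :
    Integrable (fun ω => ‖deviation (state P n x₀ t ω)‖ ^ 2) μ ∧
      ∃ c : ℝ, 0 ≤ c ∧ c ≤ ‖x₀‖ ^ 2 * disagreement μ P t ∧
        ∫ ω, ‖deviation (state P n x₀ t ω)‖ ^ 2 ∂μ =
          c + σ ^ 2 * ∑ k ∈ Finset.range t, disagreement μ P k := by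
  -- the index `none` stands for the initial state, with the constant variable `1` as its noise
  let w : Fin N → Option (Fin t × Fin N) → (ℕ → Matrix (Fin N) (Fin N) ℝ) → ℝ := fun l a p =>
    match a with
    | none => ∑ i, (transition p 0 t l i - (N : ℝ)⁻¹) * x₀ i
    | some (s, i) => transition p (s + 1) (t - 1 - s) l i - (N : ℝ)⁻¹
  let z : Option (Fin t × Fin N) → (ℕ → EuclideanSpace ℝ (Fin N)) → ℝ := fun a v =>
    match a with
    | none => 1
    | some (s, i) => v s i
  have hwm : ∀ l a, Measurable (w l a) := by
    have hT : ∀ s k l i, Measurable fun p : ℕ → Matrix (Fin N) (Fin N) ℝ =>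
        transition p s k l i - (N : ℝ)⁻¹ := fun s k l i =>
      (measurable_matrix_iff.1 (NoisyConsensus.measurable_transition s k) l i).sub_const _
    rintro l (_ | ⟨s, i⟩)
    · exact Finset.measurable_sum _ fun i _ => (hT 0 t l i).mul_const _
    · exact hT _ _ _ _
  have hzm : ∀ a, Measurable (z a) := by
    rintro (_ | ⟨s, i⟩)
    · exact measurable_const
    · change Measurable fun v : ℕ → EuclideanSpace ℝ (Fin N) => v s i
      fun_prop
  have hW : ∀ l a, MemLp (fun ω => w l a fun t => P t ω) 2 μ := by
    have hT : ∀ s k l i, MemLp (fun ω =>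
        transition (fun t => P t ω) s k l i - (N : ℝ)⁻¹) 2 μ := fun s k l i =>
      (hP.memLp_transition_apply s k l i 2).sub (memLp_const _)
    rintro l (_ | ⟨s, i⟩)
    · exact memLp_finsetSum _ fun i _ => (hT 0 t l i).mul_const _
    · exact hT _ _ _ _
  have hZ : ∀ a, MemLp (fun ω => z a fun t => n t ω) 2 μ := by
    rintro (_ | ⟨s, i⟩)
    · exact memLp_const _
    · exact hnL2 s i
  have hind : ∀ l, IndepFun (fun ω a => w l a fun t => P t ω) (fun ω a => z a fun t => n t ω) μ :=
    fun l => hnP.comp (measurable_pi_lambda _ (hwm l)) (measurable_pi_lambda _ hzm)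
  have horth : ∀ a b, a ≠ b →
      ∫ ω, z a (fun t => n t ω) * z b (fun t => n t ω) ∂μ = 0 := by
    rintro (_ | ⟨s, i⟩) (_ | ⟨r, j⟩) hab
    · exact absurd rfl hab
    · simpa [z] using hnmean r j
    · simpa [z] using hnmean s i
    · refine hnorth s i r j fun h => hab ?_
      rw [Prod.mk.injEq] at h
      rw [Fin.ext h.1, h.2]
  have key := fun l => integral_sq_sum_mul (hW l) hZ (hind l) horth
  have hdev : (fun ω => ‖deviation (state P n x₀ t ω)‖ ^ 2) =ᵐ[μ] fun ω =>
      ∑ l, (∑ a, w l a (fun t => P t ω) * z a fun t => n t ω) ^ 2 := by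
    filter_upwards [hP.stoch, hP.symm] with ω hω hs
    have hcol := transition_mem_colStochastic
      fun t => IsSymm.mem_colStochastic (hs t) (hω t)
    rw [EuclideanSpace.real_norm_sq_eq]
    refine Finset.sum_congr rfl fun l _ => congrArg (· ^ 2) ?_
    rw [deviation_apply, state_eq, Fintype.sum_option, Fintype.sum_prod_type]
    simp only [w, z, mul_one, Pi.add_apply, Finset.sum_apply, Finset.sum_add_distrib]
    rw [← mulVec_sub_average (hcol 0 t)]
    simp only [← mulVec_sub_average (hcol _ _)]
    rw [Fin.sum_univ_eq_sum_range (fun s =>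
      (transition (fun t => P t ω) (s + 1) (t - 1 - s) *ᵥ (n s ω).ofLp) l - (N : ℝ)⁻¹ *
        ∑ i, (transition (fun t => P t ω) (s + 1) (t - 1 - s) *ᵥ (n s ω).ofLp) i),
      Finset.sum_sub_distrib, ← Finset.mul_sum, Finset.sum_comm (s := Finset.range t)]
    ring
  have hsum : Integrable (fun ω =>
      ∑ l, (∑ a, w l a (fun t => P t ω) * z a fun t => n t ω) ^ 2) μ :=
    integrable_finsetSum _ fun l _ => (key l).1
  refine ⟨hsum.congr hdev.symm, ∑ l, ∫ ω, w l none (fun t => P t ω) ^ 2 ∂μ,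
    Finset.sum_nonneg fun l _ => integral_nonneg fun ω => sq_nonneg _, ?_, ?_⟩
  · rw [← hP.sum_integral_transition_sub_sq hN 0 t, Finset.mul_sum]
    refine Finset.sum_le_sum fun l _ => ?_
    have hint : ∀ i, Integrable
        (fun ω => (transition (fun t => P t ω) 0 t l i - (N : ℝ)⁻¹) ^ 2) μ :=
      fun i => ((hP.memLp_transition_apply 0 t l i 2).sub (memLp_const _)).integrable_sq
    rw [← integral_finsetSum _ fun i _ => hint i, ← integral_const_mul]
    refine integral_mono (hW l none).integrable_sq
      ((integrable_finsetSum _ fun i _ => hint i).const_mul _) fun ω => ?_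
    simp only [w]
    rw [EuclideanSpace.real_norm_sq_eq, mul_comm]
    exact Finset.sum_mul_sq_le_sq_mul_sq _ _ _
  · rw [integral_congr_ae hdev, integral_finsetSum _ fun l _ => (key l).1,
      Finset.sum_congr rfl fun l _ => (key l).2]
    simp only [Fintype.sum_option, Fintype.sum_prod_type, z, hnsq]
    rw [Finset.sum_add_distrib]
    congr 1
    · simp
    · rw [Finset.sum_comm, Finset.mul_sum,
        ← Finset.sum_range_reflect (fun k => σ ^ 2 * disagreement μ P k),
        ← Fin.sum_univ_eq_sum_range (fun k => σ ^ 2 * disagreement μ P (t - 1 - k))]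
      refine Finset.sum_congr rfl fun s _ => ?_
      rw [← hP.sum_integral_transition_sub_sq hN (s + 1) (t - 1 - s)]
      simp only [w, Finset.mul_sum]
      exact Finset.sum_congr rfl fun l _ => Finset.sum_congr rfl fun i _ => mul_comm _ _

/-! ### The bounds -/

lemma isHermitian_expMatrix (hP : IsIIDSymmStochastic μ P) : (expMatrix μ (P 0)).IsHermitian := by
  rw [IsHermitian, conjTranspose_eq_transpose_of_trivial]
  exact hP.expMatrix_isSymm

lemma isHermitian_expMatrix_sq (hP : IsIIDSymmStochastic μ P) :
    (expMatrix μ fun ω => P 0 ω ^ 2).IsHermitian := by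
  rw [IsHermitian, conjTranspose_eq_transpose_of_trivial]
  exact hP.expMatrix_sq_isSymm

lemma dotProduct_expMatrix_sq_mulVec_nonneg [IsProbabilityMeasure μ]
    (hP : IsIIDSymmStochastic μ P) (u : Fin N → ℝ) :
    0 ≤ u ⬝ᵥ (expMatrix μ fun ω => P 0 ω ^ 2) *ᵥ u := by
  rw [hP.dotProduct_expMatrix_sq_mulVec]
  exact Finset.sum_nonneg fun i _ => integral_nonneg fun ω => sq_nonneg _

lemma dotProduct_expMatrix_sq_mulVec_lt [IsProbabilityMeasure μ] (hP : IsIIDSymmStochastic μ P)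
    (hdiag : ∀ᵐ ω ∂μ, ∀ i, 0 < P 0 ω i i)
    (hreach : HasGloballyReachableNode (expMatrix μ (P 0))) (u : Fin N → ℝ)
    (hu : ¬ ∃ c : ℝ, u = c • 1) : u ⬝ᵥ (expMatrix μ fun ω => P 0 ω ^ 2) *ᵥ u < u ⬝ᵥ u := by
  obtain ⟨v, hv⟩ := hreach
  refine dotProduct_mulVec_lt hP.expMatrix_sq_isSymm hP.expMatrix_sq_mulVec_one
    hP.expMatrix_sq_nonneg ⟨v, fun i => ?_⟩ u hu
  exact Relation.ReflTransGen.mono (fun i j hij => hP.expMatrix_sq_pos hdiag hij) i v (hv i)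

lemma eig_expMatrix_sq [IsProbabilityMeasure μ] (hP : IsIIDSymmStochastic μ P) (hN : 0 < N)
    (hdiag : ∀ᵐ ω ∂μ, ∀ i, 0 < P 0 ω i i)
    (hreach : HasGloballyReachableNode (expMatrix μ (P 0))) :
    eig hP.isHermitian_expMatrix_sq 1 = 1 ∧
      ∀ i ∈ Finset.Icc 2 N, |eig hP.isHermitian_expMatrix_sq i| < 1 := by
  refine eig_of_quadratic_form hN _ hP.expMatrix_sq_mulVec_one fun u hu => ?_
  rw [abs_of_nonneg (hP.dotProduct_expMatrix_sq_mulVec_nonneg u)]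
  exact hP.dotProduct_expMatrix_sq_mulVec_lt hdiag hreach u hu

/-- By Cauchy-Schwarz and Jensen, `(uᵀ 𝔼[P] u)² ≤ ‖u‖² * uᵀ 𝔼[P ^ 2] u`, so that `𝔼[P]` inherits
the strict contraction from `𝔼[P ^ 2]`. -/
lemma eig_expMatrix [IsProbabilityMeasure μ] (hP : IsIIDSymmStochastic μ P) (hN : 0 < N)
    (hdiag : ∀ᵐ ω ∂μ, ∀ i, 0 < P 0 ω i i)
    (hreach : HasGloballyReachableNode (expMatrix μ (P 0))) :
    eig hP.isHermitian_expMatrix 1 = 1 ∧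
      ∀ i ∈ Finset.Icc 2 N, |eig hP.isHermitian_expMatrix i| < 1 := by
  refine eig_of_quadratic_form hN _ hP.expMatrix_mulVec_one fun u hu => ?_
  have h1 := hP.dotProduct_expMatrix_sq_mulVec_lt hdiag hreach u hu
  have h2 := hP.dotProduct_expMatrix_mulVec_self_le u
  have h0 := hP.dotProduct_expMatrix_sq_mulVec_nonneg u
  have hcs : (u ⬝ᵥ expMatrix μ (P 0) *ᵥ u) ^ 2 ≤
      (u ⬝ᵥ u) * ((expMatrix μ (P 0) *ᵥ u) ⬝ᵥ (expMatrix μ (P 0) *ᵥ u)) := by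
    have := Finset.sum_mul_sq_le_sq_mul_sq Finset.univ u (expMatrix μ (P 0) *ᵥ u)
    simpa only [dotProduct, pow_two] using this
  refine abs_lt_of_sq_lt_sq ?_ (h0.trans h1.le)
  refine hcs.trans_lt ?_
  rw [pow_two]
  exact mul_lt_mul_of_pos_left (h2.trans_lt h1) (h0.trans_lt h1)

lemma eigenvalues_expMatrix_sq_nonneg [IsProbabilityMeasure μ] (hP : IsIIDSymmStochastic μ P)
    (i : Fin N) : 0 ≤ hP.isHermitian_expMatrix_sq.eigenvalues i := by
  rw [← eigenvectorBasis_dotProduct_mulVec]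
  exact hP.dotProduct_expMatrix_sq_mulVec_nonneg _

lemma disagreement_le [IsProbabilityMeasure μ] (hP : IsIIDSymmStochastic μ P) (k : ℕ) :
    disagreement μ P k ≤ ((expMatrix μ fun ω => P 0 ω ^ 2) ^ k).trace - 1 :=
  sub_le_sub_right (vec_one_dotProduct_pow_mulVec_vec_one_le hP.isHermitian_expMatrix_sq
    hP.eigenvalues_expMatrix_sq_nonneg hP.secondMoment_isSymm
    hP.vec_dotProduct_secondMoment_pow_nonneg hP.secondMoment_mulVec_vec_one k) 1

/-- The second moment of a product of `k` update matrices is at least the square of its mean,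
which is `𝔼[P] ^ k`. -/
lemma le_disagreement [IsProbabilityMeasure μ] (hP : IsIIDSymmStochastic μ P) (k : ℕ) :
    (expMatrix μ (P 0) ^ (2 * k)).trace - 1 ≤ disagreement μ P k := by
  have h := hP.sum_integral_transition_sq 0 k
  have hle : ∑ l, ∑ i, (expMatrix μ (P 0) ^ k) l i ^ 2 ≤
      ∑ l, ∑ i, ∫ ω, transition (fun t => P t ω) 0 k l i ^ 2 ∂μ :=
    Finset.sum_le_sum fun l _ => Finset.sum_le_sum fun i _ => by
      rw [← hP.integral_transition 0 k l i]
      exact sq_integral_le (hP.memLp_transition_apply 0 k l i 2)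
  have htr : (expMatrix μ (P 0) ^ (2 * k)).trace = ∑ l, ∑ i, (expMatrix μ (P 0) ^ k) l i ^ 2 := by
    rw [two_mul, pow_add, trace]
    refine Finset.sum_congr rfl fun l _ => ?_
    rw [diag_apply, Matrix.mul_apply]
    refine Finset.sum_congr rfl fun i _ => ?_
    rw [(hP.expMatrix_isSymm.pow k).apply l i, pow_two]
  linarith

lemma disagreement_nonneg [IsProbabilityMeasure μ] (hP : IsIIDSymmStochastic μ P) (hN : 0 < N)
    (k : ℕ) : 0 ≤ disagreement μ P k := by
  rw [← hP.sum_integral_transition_sub_sq hN 0 k]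
  exact Finset.sum_nonneg fun l _ => Finset.sum_nonneg fun i _ =>
    integral_nonneg fun ω => sq_nonneg _

end IsIIDSymmStochastic

end NoisyConsensus

theorem theorem2 {Ω : Type*} [MeasurableSpace Ω] (μ : Measure Ω) [IsProbabilityMeasure μ]
    (N : ℕ)
    -- the random update matrices: i.i.d., symmetric, stochastic, with positive diagonal, and
    -- with an expectation whose graph has a globally reachable node
    (P : ℕ → Ω → Matrix (Fin N) (Fin N) ℝ)
    (hPmeas : ∀ t, Measurable (P t))
    (hPindep : iIndepFun P μ)
    (hPident : ∀ t, IdentDistrib (P t) (P 0) μ μ)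
    (hPstoch : ∀ t, ∀ᵐ ω ∂μ, P t ω ∈ Matrix.rowStochastic ℝ (Fin N))
    (hPsymm : ∀ t, ∀ᵐ ω ∂μ, (P t ω).IsSymm)
    (hPdiag : ∀ t, ∀ᵐ ω ∂μ, ∀ i, 0 < P t ω i i)
    (hPreach : NoisyConsensus.HasGloballyReachableNode (NoisyConsensus.expMatrix μ (P 0)))
    -- the noise: zero mean, variance `σ ^ 2`, uncorrelated in time and across components,
    -- independent of the update matrices
    (σ : ℝ) (n : ℕ → Ω → EuclideanSpace ℝ (Fin N))
    (hnmeas : ∀ t, Measurable (n t))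
    (hnL2 : ∀ t i, MemLp (fun ω => n t ω i) 2 μ)
    (hnmean : ∀ t i, ∫ ω, n t ω i ∂μ = 0)
    (hnvar : ∀ t i, variance (fun ω => n t ω i) μ = σ ^ 2)
    (hncorr : ∀ t i s j, (t, i) ≠ (s, j) →
      covariance (fun ω => n t ω i) (fun ω => n s ω j) μ = 0)
    (hnP : IndepFun (fun ω t => P t ω) (fun ω t => n t ω) μ)
    (x₀ : EuclideanSpace ℝ (Fin N)) :
    ∃ (hP₁ : (NoisyConsensus.expMatrix μ (P 0)).IsHermitian)
      (hP₂ : (NoisyConsensus.expMatrix μ (fun ω => P 0 ω ^ 2)).IsHermitian)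
      (J : ℝ),
      -- `J` is the noise index: the expectations are finite and the limit exists
      (∀ t, Integrable
        (fun ω => ‖NoisyConsensus.deviation (NoisyConsensus.state P n x₀ t ω)‖ ^ 2) μ) ∧
      Tendsto (fun t : ℕ => 1 / (N : ℝ) *
          ∫ ω, ‖NoisyConsensus.deviation (NoisyConsensus.state P n x₀ t ω)‖ ^ 2 ∂μ)
        atTop (𝓝 J) ∧
      -- the denominators in the bounds are positive
      (∀ i ∈ Finset.Icc 2 N, 0 < 1 - NoisyConsensus.eig hP₁ i ^ 2) ∧
      (∀ i ∈ Finset.Icc 2 N, 0 < 1 - NoisyConsensus.eig hP₂ i) ∧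
      -- the bounds
      σ ^ 2 / N * ∑ i ∈ Finset.Icc 2 N, 1 / (1 - NoisyConsensus.eig hP₁ i ^ 2) ≤ J ∧
      J ≤ σ ^ 2 / N * ∑ i ∈ Finset.Icc 2 N, 1 / (1 - NoisyConsensus.eig hP₂ i) := by
  have hP : NoisyConsensus.IsIIDSymmStochastic μ P :=
    ⟨hPmeas, hPindep, hPident, ae_all_iff.2 hPstoch, ae_all_iff.2 hPsymm⟩
  have hN : 0 < N := by
    obtain ⟨v, -⟩ := hPreach
    exact v.pos
  have hnint : ∀ t i, Integrable (fun ω => n t ω i) μ := fun t i =>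
    (hnL2 t i).integrable one_le_two
  have hnsq : ∀ t i, ∫ ω, n t ω i ^ 2 ∂μ = σ ^ 2 := fun t i => by
    rw [← hnvar t i, variance_of_integral_eq_zero (hnint t i).aemeasurable (hnmean t i)]
  have hnorth : ∀ t i s j, (t, i) ≠ (s, j) → ∫ ω, n t ω i * n s ω j ∂μ = 0 := by
    intro t i s j h
    have h1 := hncorr t i s j h
    rw [covariance_eq_sub (hnL2 t i) (hnL2 s j), hnmean t i, zero_mul, sub_zero] at h1
    exact h1
  have hvar := hP.integral_norm_deviation_sq hN hnL2 hnmean hnsq hnorth hnP x₀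
  obtain ⟨htop₁, hlt₁⟩ := hP.eig_expMatrix hN (hPdiag 0) hPreach
  obtain ⟨htop₂, hlt₂⟩ := hP.eig_expMatrix_sq hN (hPdiag 0) hPreach
  have hsq₁ : ∀ i ∈ Finset.Icc 2 N, NoisyConsensus.eig hP.isHermitian_expMatrix i ^ 2 < 1 :=
    fun i hi => (sq_lt_one_iff_abs_lt_one _).2 (hlt₁ i hi)
  set a := NoisyConsensus.disagreement μ P with ha
  have hlower : HasSum
      (fun k => ∑ i ∈ Finset.Icc 2 N, (NoisyConsensus.eig hP.isHermitian_expMatrix i ^ 2) ^ k)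
      (∑ i ∈ Finset.Icc 2 N, 1 / (1 - NoisyConsensus.eig hP.isHermitian_expMatrix i ^ 2)) :=
    hasSum_sum fun i hi => by
      rw [one_div]
      exact hasSum_geometric_of_lt_one (sq_nonneg _) (hsq₁ i hi)
  have hupper : HasSum
      (fun k => ∑ i ∈ Finset.Icc 2 N, NoisyConsensus.eig hP.isHermitian_expMatrix_sq i ^ k)
      (∑ i ∈ Finset.Icc 2 N, 1 / (1 - NoisyConsensus.eig hP.isHermitian_expMatrix_sq i)) :=
    hasSum_sum fun i hi => by
      rw [one_div]
      exact hasSum_geometric_of_abs_lt_one (hlt₂ i hi)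
  have hle : ∀ k, a k ≤
      ∑ i ∈ Finset.Icc 2 N, NoisyConsensus.eig hP.isHermitian_expMatrix_sq i ^ k := fun k => by
    rw [← NoisyConsensus.trace_pow_sub_one hN _ htop₂]
    exact hP.disagreement_le k
  have hge : ∀ k, ∑ i ∈ Finset.Icc 2 N, (NoisyConsensus.eig hP.isHermitian_expMatrix i ^ 2) ^ k ≤
      a k := fun k => by
    simp only [← pow_mul]
    rw [← NoisyConsensus.trace_pow_sub_one hN _ htop₁]
    exact hP.le_disagreement k
  have hsum : Summable a :=
    Summable.of_nonneg_of_le (hP.disagreement_nonneg hN) hle hupper.summable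
  have hσN : 0 ≤ σ ^ 2 / N := by positivity
  refine ⟨hP.isHermitian_expMatrix, hP.isHermitian_expMatrix_sq, σ ^ 2 / N * ∑' k, a k,
    fun t => (hvar t).1, ?_, fun i hi => sub_pos.2 (hsq₁ i hi),
    fun i hi => sub_pos.2 (abs_lt.1 (hlt₂ i hi)).2,
    mul_le_mul_of_nonneg_left (hasSum_le hge hlower hsum.hasSum) hσN,
    mul_le_mul_of_nonneg_left (hasSum_le hle hsum.hasSum hupper) hσN⟩
  choose c hc0 hc1 hc2 using fun t => (hvar t).2
  simp only [hc2]
  have hc : Tendsto c atTop (𝓝 0) := by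
    refine squeeze_zero hc0 hc1 ?_
    simpa using hsum.tendsto_atTop_zero.const_mul (‖x₀‖ ^ 2)
  have hlim := (hc.add (hsum.hasSum.tendsto_sum_nat.const_mul (σ ^ 2))).const_mul (1 / (N : ℝ))
  rw [show σ ^ 2 / N * ∑' k, a k = 1 / (N : ℝ) * (0 + σ ^ 2 * ∑' k, a k) by ring]
  exact hlim
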